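/- Let $A$ be an integral domain. An ideal $I$ of $A$ is called invertible if it is invertible as a fractional ideal of $A$. For a nonzero ideal $I$ let $I_\nu=(A:(A:I))$ be its divisorial closure, computed in the fraction field of $A$; $I$ is divisorial if $I=I_\nu$. We say that: - $A$ is almost Dedekind if for every maximal ideal $M$ the localization $A_M$ is a rank one discrete valuation domain (in particular, $A$ is not a field); - $A$ has weak factorization if every nonzero nondivisorial ideal $I$ can be written as $I=I_\nu M_1\cdots M_n$ with $M_1,\dots,M_n$ maximal ideals; - $A$ is an SP-domain if every ideal of $A$ is a finite product of radical ideals; - $A$ is an ISP-domain if every proper nonzero ideal of $A$ can be written as $JQ_1\cdots Q_n$ with $n\ge 1$, $J$ an invertible ideal of $A$ and each $Q_i$ a proper radical ideal. Let $Z$ be the set of noninvertible maximal ideals of $A$, and for an ideal $I$ and $n\ge 1$ put $V_n(I)=\{M\in \mathrm{Max}(A)\mid I\subseteq M^n\}$. An ideal $H$ is called clean if $H$ is invertible, $V_1(H)\cap Z=\{M\}$ for a single maximal ideal $M$, and $H\not\subseteq M^2$. Theorem. Let $A$ be an almost Dedekind domain which has weak factorization. Then the following assertions are equivalent: (a) $A$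 is an SP-domain. (b) $A$ is an ISP-domain. (c) For every clean ideal $H$ of $A$, the set $V_2(H)$ is finite. (d) Every $M\in Z$ contains a clean ideal $H$ such that $V_2(H)$ is finite. -/

import Mathlib

open scoped nonZeroDivisors

namespace SemiprimeFactorization

section

variable (A : Type*) [CommRing A] [IsDomain A]

/-- `A` is almost Dedekind: every localization at a maximal ideal is a rank one discrete
valuation domain (in particular `A` is not a field). -/
def IsAlmostDedekind : Prop :=
  ∀ (M : Ideal A) [M.IsMaximal], IsDiscreteValuationRing (Localization.AtPrime M)

/-- `A` is an SP-domain: every ideal is a finite product of radical ideals. -/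
def IsSPDomain : Prop :=
  ∀ I : Ideal A, ∃ s : Multiset (Ideal A), (∀ Q ∈ s, Q.IsRadical) ∧ I = s.prod

variable {A}

/-- An (integral) ideal is invertible: it is a unit in the monoid of fractional ideals. -/
def IsInvertible (I : Ideal A) : Prop :=
  IsUnit (I : FractionalIdeal A⁰ (FractionRing A))

/-- The divisorial closure `(A : (A : I))` of a nonzero ideal, as a fractional ideal. -/
noncomputable def divisorialClosure (I : Ideal A) : FractionalIdeal A⁰ (FractionRing A) :=
  ((I : FractionalIdeal A⁰ (FractionRing A))⁻¹)⁻¹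

/-- An ideal is divisorial if it equals its divisorial closure. -/
def IsDivisorial (I : Ideal A) : Prop :=
  divisorialClosure I = (I : FractionalIdeal A⁰ (FractionRing A))

variable (A)

/-- `A` is an ISP-domain: every proper nonzero ideal is the product of an invertible ideal and a
nonempty finite product of proper radical ideals. -/
def IsISPDomain : Prop :=
  ∀ I : Ideal A, I ≠ ⊥ → I ≠ ⊤ →
    ∃ (J : Ideal A) (s : Multiset (Ideal A)),
      IsInvertible J ∧ s ≠ 0 ∧ (∀ Q ∈ s, Q ≠ ⊤ ∧ Q.IsRadical) ∧ I = J * s.prod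

/-- `A` has weak factorization: every nonzero nondivisorial ideal is the product of its divisorial
closure and a finite product of maximal ideals. -/
def HasWeakFactorization : Prop :=
  ∀ I : Ideal A, I ≠ ⊥ → ¬ IsDivisorial I →
    ∃ s : Multiset (Ideal A), (∀ M ∈ s, M.IsMaximal) ∧
      (I : FractionalIdeal A⁰ (FractionRing A)) =
        divisorialClosure I * ((s.prod : Ideal A) : FractionalIdeal A⁰ (FractionRing A))

/-- The set `Z` of noninvertible maximal ideals. -/
def noninvertibleMax : Set (Ideal A) :=
  {M | M.IsMaximal ∧ ¬ IsInvertible M}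

variable {A}

/-- `V n I` is the set of maximal ideals `M` with `I ⊆ M ^ n`. -/
def V (n : ℕ) (I : Ideal A) : Set (Ideal A) :=
  {M | M.IsMaximal ∧ I ≤ M ^ n}

/-- `H` is a clean ideal: `H` is invertible, exactly one noninvertible maximal ideal `M`
contains `H`, and `H` is not contained in `M ^ 2`. -/
def IsClean (H : Ideal A) : Prop :=
  IsInvertible H ∧ ∃ M : Ideal A, V 1 H ∩ noninvertibleMax A = {M} ∧ ¬ H ≤ M ^ 2

end

end SemiprimeFactorization

/-!
The order of an element at a maximal ideal `M` is its valuation in the discrete valuation ring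
`A_M`; the order of a nonzero ideal is the least order of its elements. A nonzero ideal is
determined by its orders at all maximal ideals (`le_of_forall_le_pow`), and finitely generated
nonzero ideals are invertible (`isInvertible_of_fg`).

An SP-domain is trivially an ISP-domain.

In an ISP-domain `V 2 H` is finite for every clean `H`: let `M` be the noninvertible maximal ideal
above `H`. Every neighbourhood of `M` contains all but finitely many of the maximal ideals above `H`
(`finite_V_one_sup`). If `V 2 H` were infinite, one could prescribe an ideal whose order is `1` at
`M`, at least `2` at infinitely many members of `V 2 H` and `0` at infinitely many others; a factor
of it contained in `M` can be neither invertible nor radical (`IsClean.finite_V_two`).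

The next implication amounts to the existence of clean ideals, and it is here that weak
factorization enters: it forces a nonzero element to lie in only finitely many noninvertible maximal
ideals (`finite_noninvertibleMax`), after which a clean ideal inside `M` is found by adjoining
finitely many elements to an element of order `1` at `M` (`exists_isClean_le`).

Finally, suppose that every noninvertible maximal ideal contains a clean `H` with `V 2 H` finite.
Enlarging `H` to avoid the members of `V 2 H`, one gets inside every maximal ideal a finitely
generated ideal that has order at most `1` everywhere (`exists_fg_forall_not_le_sq`). Comparing an
element locally with a power of such an ideal shows that the order function of a nonzero ideal `I`
is bounded and that the intersection of the maximal ideals at which `I` has order at least `k` has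
order `1` at these and `0` elsewhere. Hence `I` is the product of these radical ideals over
all `k ≥ 1` (`isSPDomain_of_forall_exists_fg`).
-/

open scoped nonZeroDivisors

namespace SemiprimeFactorization

variable {A : Type*} [CommRing A] [IsDomain A]

/-! ### The order of an element at a maximal ideal -/

/-- The order of `x` at the maximal ideal `M` of an almost Dedekind domain: the normalized
valuation of `x` in the discrete valuation ring `A_M`, with value `⊤` at `x = 0`. -/
noncomputable def ordAt (hA : IsAlmostDedekind A) (M : Ideal A) [M.IsMaximal] (x : A) : ℕ∞ :=
  haveI := hA M
  IsDiscreteValuationRing.addVal (Localization.AtPrime M) (algebraMap A _ x)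

section ordAt

variable (hA : IsAlmostDedekind A) {M : Ideal A} [M.IsMaximal]

theorem ordAt_mul (x y : A) : ordAt hA M (x * y) = ordAt hA M x + ordAt hA M y := by
  simp [ordAt]

theorem le_ordAt_iff {x : A} {k : ℕ} : (k : ℕ∞) ≤ ordAt hA M x ↔ x ∈ M ^ k := by
  have := hA M
  obtain ⟨ϖ, hϖ⟩ := IsDiscreteValuationRing.exists_irreducible (Localization.AtPrime M)
  rw [ordAt, ← IsLocalization.AtPrime.under_maximalIdeal_pow M (Localization.AtPrime M),
    Ideal.mem_comap, hϖ.maximalIdeal_eq, Ideal.span_singleton_pow, Ideal.mem_span_singleton,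
    ← IsDiscreteValuationRing.addVal_le_iff_dvd, hϖ.addVal_pow]

theorem ordAt_ne_top {x : A} (hx : x ≠ 0) : ordAt hA M x ≠ ⊤ := by
  have := hA M
  rw [ordAt, Ne, IsDiscreteValuationRing.addVal_eq_top_iff]
  simpa using hx

/-- Divisibility in the valuation ring `A_M`, with denominators cleared. -/
theorem exists_mul_eq_mul_of_ordAt_le {a x : A} (h : ordAt hA M a ≤ ordAt hA M x) :
    ∃ s ∉ M, ∃ r, s * x = r * a := by
  have := hA M
  obtain ⟨c, hc⟩ := IsDiscreteValuationRing.addVal_le_iff_dvd.1 h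
  obtain ⟨⟨r, s⟩, hrs⟩ := IsLocalization.surj M.primeCompl c
  refine ⟨s, s.2, r, IsLocalization.injective (Localization.AtPrime M)
    M.primeCompl_le_nonZeroDivisors ?_⟩
  simp only at hrs
  rw [map_mul, map_mul, hc, ← hrs]
  ring

theorem one_le_ordAt_iff {x : A} : 1 ≤ ordAt hA M x ↔ x ∈ M := by
  simpa using le_ordAt_iff hA (M := M) (x := x) (k := 1)

theorem ordAt_eq_zero_iff {x : A} : ordAt hA M x = 0 ↔ x ∉ M := by
  rw [← one_le_ordAt_iff hA, Order.one_le_iff_ne_zero, not_not]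

theorem ordAt_pow (x : A) (n : ℕ) : ordAt hA M (x ^ n) = n * ordAt hA M x := by
  have := hA M
  simp [ordAt]

theorem exists_ordAt_eq_one (M : Ideal A) [M.IsMaximal] : ∃ u, ordAt hA M u = 1 := by
  have := hA M
  obtain ⟨ϖ, hϖ⟩ := IsDiscreteValuationRing.exists_irreducible (Localization.AtPrime M)
  obtain ⟨⟨r, s⟩, hrs⟩ := IsLocalization.surj M.primeCompl ϖ
  have hs : ordAt hA M s = 0 := (ordAt_eq_zero_iff hA).2 s.2
  refine ⟨r, ?_⟩
  rw [ordAt] at hs ⊢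
  rw [← hrs, IsDiscreteValuationRing.addVal_mul, hs, add_zero,
    IsDiscreteValuationRing.addVal_uniformizer hϖ]

theorem exists_ordAt_minimal (M : Ideal A) [M.IsMaximal] {I : Ideal A} (hI : I ≠ ⊥) :
    ∃ c ∈ I, c ≠ 0 ∧ ∀ x ∈ I, ordAt hA M c ≤ ordAt hA M x := by
  obtain ⟨c, hcI, hc⟩ := WellFounded.has_min (InvImage.wf (ordAt hA M) wellFounded_lt)
    (I : Set A) ⟨0, I.zero_mem⟩
  have hmin : ∀ x ∈ I, ordAt hA M c ≤ ordAt hA M x := fun x hx => not_lt.1 (hc x hx)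
  obtain ⟨y, hy, hy0⟩ := Submodule.exists_mem_ne_zero_of_ne_bot hI
  refine ⟨c, hcI, ?_, hmin⟩
  rintro rfl
  have h := hmin y hy
  rw [(by simp [ordAt] : ordAt hA M (0 : A) = ⊤), top_le_iff] at h
  exact ordAt_ne_top hA hy0 h

end ordAt

/-! ### Passing between local and global statements -/

/-- Membership in an ideal is a local property. -/
theorem mem_of_forall_maximal {A : Type*} [CommRing A] {J : Ideal A} {x : A}
    (h : ∀ M : Ideal A, M.IsMaximal → ∃ s ∉ M, s * x ∈ J) : x ∈ J := by
  set K : Ideal A := Submodule.comap (LinearMap.toSpanSingleton A A x) J with hK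
  have hmem : ∀ s, s ∈ K ↔ s * x ∈ J := fun s => by simp [hK]
  by_contra hx
  obtain ⟨M, hM, hKM⟩ := K.exists_le_maximal
    (fun hT => hx (by simpa using (hmem 1).1 (hT ▸ Submodule.mem_top)))
  obtain ⟨s, hs, hsx⟩ := h M hM
  exact hs (hKM ((hmem s).2 hsx))

/-- The elements multiplying a finitely generated ideal into `J` can be chosen uniformly. -/
theorem exists_forall_mul_mem_of_fg {A : Type*} [CommRing A] {P I J : Ideal A} [P.IsPrime]
    (hI : I.FG)
    (h : ∀ x ∈ I, ∃ s ∉ P, s * x ∈ J) : ∃ s ∉ P, ∀ x ∈ I, s * x ∈ J := by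
  induction I, hI using Submodule.fg_induction with
  | singleton x =>
    obtain ⟨s, hs, hsx⟩ := h x (Submodule.mem_span_singleton_self x)
    refine ⟨s, hs, fun y hy => ?_⟩
    obtain ⟨r, rfl⟩ := Submodule.mem_span_singleton.1 hy
    rw [smul_eq_mul, mul_left_comm]
    exact J.mul_mem_left r hsx
  | sup I₁ I₂ _ _ h₁ h₂ =>
    obtain ⟨s, hs, hs'⟩ := h₁ fun x hx => h x (Submodule.mem_sup_left hx)
    obtain ⟨t, ht, ht'⟩ := h₂ fun x hx => h x (Submodule.mem_sup_right hx)
    refine ⟨s * t, Ideal.IsPrime.mul_notMem ‹_› hs ht, fun x hx => ?_⟩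
    obtain ⟨y, hy, z, hz, rfl⟩ := Submodule.mem_sup.1 hx
    rw [mul_add]
    refine J.add_mem ?_ ?_
    · rw [mul_right_comm, mul_comm]
      exact J.mul_mem_left t (hs' y hy)
    · rw [mul_assoc]
      exact J.mul_mem_left s (ht' z hz)

/-- In an almost Dedekind domain, containment in powers of maximal ideals determines an ideal. -/
theorem le_of_forall_le_pow (hA : IsAlmostDedekind A) {I J : Ideal A} (hJ : J ≠ ⊥)
    (h : ∀ M : Ideal A, M.IsMaximal → ∀ k : ℕ, J ≤ M ^ k → I ≤ M ^ k) : I ≤ J := by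
  intro x hx
  refine mem_of_forall_maximal fun M hM => ?_
  obtain ⟨c, hcJ, hc0, hc⟩ := exists_ordAt_minimal hA M hJ
  obtain ⟨e, he⟩ := ENat.ne_top_iff_exists.1 (ordAt_ne_top hA (M := M) hc0)
  have hIe : I ≤ M ^ e := h M hM e fun y hy => (le_ordAt_iff hA).1 (he ▸ hc y hy)
  obtain ⟨s, hs, r, hr⟩ := exists_mul_eq_mul_of_ordAt_le hA (M := M) (a := c) (x := x)
    (he ▸ (le_ordAt_iff hA).2 (hIe hx))
  exact ⟨s, hs, hr ▸ J.mul_mem_left r hcJ⟩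

/-! ### Invertible ideals -/

theorem IsInvertible.ne_bot {I : Ideal A} (hI : IsInvertible I) : I ≠ ⊥ := by
  rintro rfl
  rw [IsInvertible, FractionalIdeal.coeIdeal_bot] at hI
  exact not_isUnit_zero hI

theorem IsInvertible.fg {A : Type*} [CommRing A] {I : Ideal A} (hI : IsInvertible I) :
    I.FG :=
  Ideal.fg_of_isUnit (S := A⁰) (P := FractionRing A)
    (IsFractionRing.injective A (FractionRing A)) I hI

/-- An ideal is invertible as soon as `I * I⁻¹` lies in no maximal ideal. -/
theorem isInvertible_of_forall_maximal {I : Ideal A} (h : ∀ M : Ideal A, M.IsMaximal →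
    ∃ s ∉ M, algebraMap A (FractionRing A) s ∈
      (I : FractionalIdeal A⁰ (FractionRing A)) * (I : FractionalIdeal A⁰ (FractionRing A))⁻¹) :
    IsInvertible I := by
  rw [IsInvertible, ← FractionalIdeal.mul_inv_cancel_iff_isUnit]
  obtain ⟨K, hK⟩ := FractionalIdeal.le_one_iff_exists_coeIdeal.1
    (FractionalIdeal.mul_one_div_le_one (I := (I : FractionalIdeal A⁰ (FractionRing A))))
  rw [← FractionalIdeal.inv_eq] at hK
  rw [← hK] at h ⊢
  rw [FractionalIdeal.coeIdeal_eq_one, Ideal.one_eq_top]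
  by_contra hne
  obtain ⟨M, hM, hKM⟩ := K.exists_le_maximal hne
  obtain ⟨s, hs, hsK⟩ := h M hM
  obtain ⟨t, ht, hts⟩ := (FractionalIdeal.mem_coeIdeal A⁰).1 hsK
  exact hs (IsFractionRing.injective A (FractionRing A) hts ▸ hKM ht)

theorem isInvertible_of_fg (hA : IsAlmostDedekind A) {I : Ideal A} (hI : I ≠ ⊥) (hfg : I.FG) :
    IsInvertible I := by
  refine isInvertible_of_forall_maximal fun M hM => ?_
  obtain ⟨c, hcI, hc0, hc⟩ := exists_ordAt_minimal hA M hI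
  obtain ⟨s, hs, hsI⟩ := exists_forall_mul_mem_of_fg (P := M) (J := Ideal.span {c}) hfg
    fun x hx => by
    obtain ⟨s, hs, r, hr⟩ := exists_mul_eq_mul_of_ordAt_le hA (hc x hx)
    exact ⟨s, hs, Ideal.mem_span_singleton'.2 ⟨r, hr.symm⟩⟩
  have hc0' : algebraMap A (FractionRing A) c ≠ 0 := by simpa using hc0
  refine ⟨s, hs, ?_⟩
  -- `s / c` lies in `I⁻¹`, and its product with `c` is `s`.
  rw [← mul_div_cancel₀ (algebraMap A (FractionRing A) s) hc0']
  refine FractionalIdeal.mul_mem_mul (FractionalIdeal.mem_coeIdeal_of_mem _ hcI) ?_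
  rw [FractionalIdeal.mem_inv_iff (FractionalIdeal.coeIdeal_ne_zero.2 hI)]
  intro y hy
  obtain ⟨x, hx, rfl⟩ := (FractionalIdeal.mem_coeIdeal A⁰).1 hy
  obtain ⟨r, hr⟩ := Ideal.mem_span_singleton'.1 (hsI x hx)
  refine (FractionalIdeal.mem_one_iff A⁰).2 ⟨r, ?_⟩
  rw [div_mul_eq_mul_div, eq_div_iff hc0', ← map_mul, ← map_mul, hr]

/-- An invertible maximal ideal `N` can be split off a nonzero element `h`: the ideal `h * N⁻ᵉ`,
for `e` the order of `h` at `N`, is integral, is not contained in `N`, and agrees with `h` at every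
other maximal ideal. -/
theorem exists_notMem_forall_mem_pow (hA : IsAlmostDedekind A) {N : Ideal A} [N.IsMaximal]
    (hN : IsInvertible N) {h : A} (h0 : h ≠ 0) :
    ∃ b ∉ N, ∀ N' : Ideal A, N'.IsMaximal → N' ≠ N → ∀ k : ℕ, h ∈ N' ^ k → b ∈ N' ^ k := by
  obtain ⟨e, he⟩ := ENat.ne_top_iff_exists.1 (ordAt_ne_top hA (M := N) h0)
  have hhe : h ∈ N ^ e := (le_ordAt_iff hA).1 he.le
  have hhe' : h ∉ N ^ (e + 1) := by
    rw [← le_ordAt_iff hA, ← he]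
    exact_mod_cast Nat.not_succ_le_self e
  obtain ⟨F, hF⟩ := isUnit_iff_exists_inv.1
    (show IsUnit ((N ^ e : Ideal A) : FractionalIdeal A⁰ (FractionRing A)) by
      rw [FractionalIdeal.coeIdeal_pow]; exact IsUnit.pow e hN)
  have hle : (Ideal.span {h} : FractionalIdeal A⁰ (FractionRing A)) * F ≤ 1 := by
    rw [← hF]
    exact mul_le_mul_left (FractionalIdeal.coeIdeal_le_coeIdeal _ |>.2
      ((Ideal.span_singleton_le_iff_mem _).2 hhe)) F
  obtain ⟨B, hB⟩ := FractionalIdeal.le_one_iff_exists_coeIdeal.1 hle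
  have hBN : B * N ^ e = Ideal.span {h} := by
    rw [← FractionalIdeal.coeIdeal_inj (K := FractionRing A), FractionalIdeal.coeIdeal_mul, hB,
      mul_assoc, mul_comm F, hF, mul_one]
  have hBle : ¬ B ≤ N := fun hle => hhe' <| by
    rw [pow_succ', ← Ideal.span_singleton_le_iff_mem, ← hBN]
    exact Ideal.mul_mono_left hle
  obtain ⟨b, hbB, hbN⟩ := SetLike.not_le_iff_exists.1 hBle
  refine ⟨b, hbN, fun N' hN' hne k hk => ?_⟩
  have : ¬ N ^ e ≤ N' := fun hle =>
    hne (Ideal.IsMaximal.eq_of_le ‹_› hN'.ne_top (hN'.isPrime.le_of_pow_le hle)).symm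
  obtain ⟨u, hu, huN'⟩ := SetLike.not_le_iff_exists.1 this
  refine (Ideal.IsMaximal.mul_mem_pow N' (a := u) (b := b) ?_).resolve_left huN'
  have : u * b ∈ Ideal.span {h} := by
    rw [← hBN, mul_comm u b]; exact Ideal.mul_mem_mul hbB hu
  exact (Ideal.span_singleton_le_iff_mem _).2 hk this

/-- A nonzero ideal contained in no noninvertible maximal ideal lies in only finitely many maximal
ideals: these are isolated points of a quasicompact space. -/
theorem finite_V_one (hA : IsAlmostDedekind A) {K : Ideal A} (hK : K ≠ ⊥)
    (h : ∀ N ∈ V 1 K, IsInvertible N) : (V 1 K).Finite := by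
  obtain ⟨a, haK, ha0⟩ := Submodule.exists_mem_ne_zero_of_ne_bot hK
  have hex : ∀ N : V 1 K, ∃ b ∉ N.1,
      ∀ N' : Ideal A, N'.IsMaximal → N' ≠ N.1 → a ∈ N' → b ∈ N' := by
    rintro ⟨N, hN⟩
    have := hN.1
    obtain ⟨b, hb, hb'⟩ := exists_notMem_forall_mem_pow hA (h N hN) ha0
    exact ⟨b, hb, fun N' h₁ h₂ h₃ => by simpa using hb' N' h₁ h₂ 1 (by simpa using h₃)⟩
  choose b hb hb' using hex
  have htop : (1 : A) ∈ K ⊔ Ideal.span (Set.range b) := by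
    rw [← Ideal.eq_top_iff_one]
    by_contra hne
    obtain ⟨N, hN, hle⟩ := Ideal.exists_le_maximal _ hne
    have hKN : N ∈ V 1 K := ⟨hN, by simpa using le_sup_left.trans hle⟩
    exact hb ⟨N, hKN⟩ (hle (Submodule.mem_sup_right (Ideal.subset_span ⟨_, rfl⟩)))
  obtain ⟨k, hk, y, hy, hky⟩ := Submodule.mem_sup.1 htop
  obtain ⟨t, hyt⟩ : ∃ t : Finset (V 1 K), y ∈ Ideal.span (b '' t) := by
    classical
    obtain ⟨T, hT, hyT⟩ := Submodule.mem_span_finite_of_mem_span hy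
    rw [← Set.image_univ] at hT
    obtain ⟨t, -, rfl⟩ := Finset.subset_set_image_iff.1 hT
    exact ⟨t, by simpa using hyT⟩
  refine (t.finite_toSet.image Subtype.val).subset fun N hN => ?_
  by_contra hNt
  have hKN : K ≤ N := by simpa using hN.2
  refine hN.1.ne_top ((Ideal.eq_top_iff_one N).2 (hky ▸ N.add_mem (hKN hk) ?_))
  refine (Submodule.span_le.2 ?_) hyt
  rintro _ ⟨i, hi, rfl⟩
  exact hb' i N hN.1 (fun h => hNt ⟨i, hi, h.symm⟩) (hKN haK)

/-! ### Radical ideals -/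

theorem not_le_sq_of_isRadical (hA : IsAlmostDedekind A) {Q : Ideal A} (hQ : Q.IsRadical)
    (h0 : Q ≠ ⊥) (N : Ideal A) [N.IsMaximal] : ¬ Q ≤ N ^ 2 := by
  intro hle
  obtain ⟨h, hhQ, h0⟩ := Submodule.exists_mem_ne_zero_of_ne_bot h0
  obtain ⟨e, he⟩ := ENat.ne_top_iff_exists.1 (ordAt_ne_top hA (M := N) h0)
  obtain ⟨u, hu⟩ := exists_ordAt_eq_one hA N
  obtain ⟨s, hs, r, hr⟩ := exists_mul_eq_mul_of_ordAt_le hA (M := N) (a := h) (x := u ^ e)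
    (by rw [ordAt_pow, hu, ← he, mul_one])
  have hsu : s * u ∈ Q := hQ ⟨e + 1, by
    rw [show (s * u) ^ (e + 1) = s ^ e * u * (s * u ^ e) by ring, hr]
    exact Q.mul_mem_left _ (Q.mul_mem_left _ hhQ)⟩
  have := (le_ordAt_iff hA).2 (hle hsu)
  rw [ordAt_mul, hu, (ordAt_eq_zero_iff hA).2 hs] at this
  norm_num at this

/-! ### Noninvertible maximal ideals under weak factorization -/

/-- A noninvertible maximal ideal `M` satisfies `M⁻¹ = A`. -/
theorem mem_one_of_forall_mul_mem_one (hA : IsAlmostDedekind A) {M : Ideal A}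
    (hM : M ∈ noninvertibleMax A) {x : FractionRing A}
    (hx : ∀ m ∈ M, x * algebraMap A _ m ∈ (1 : FractionalIdeal A⁰ (FractionRing A))) :
    x ∈ (1 : FractionalIdeal A⁰ (FractionRing A)) := by
  have hMmax := hM.1
  obtain ⟨u, hu⟩ := exists_ordAt_eq_one hA M
  have huM : u ∈ M := (one_le_ordAt_iff hA).1 hu.ge
  have hM0 : M ≠ ⊥ := by
    rintro rfl
    obtain rfl : u = 0 := huM
    exact absurd hu (by simp [ordAt])
  -- Since `M` is not invertible, `x * M ⊆ M * M⁻¹ = M`.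
  have hxM : ∀ m ∈ M, ∃ r ∈ M, algebraMap A _ r = x * algebraMap A (FractionRing A) m := by
    intro m hm
    obtain ⟨r, hr⟩ := (FractionalIdeal.mem_one_iff A⁰).1 (hx m hm)
    refine ⟨r, ?_, hr⟩
    by_contra hrM
    refine hM.2 (isInvertible_of_forall_maximal fun N hN => ?_)
    by_cases hNM : N = M
    · refine ⟨r, hNM ▸ hrM, ?_⟩
      rw [hr, mul_comm x]
      refine FractionalIdeal.mul_mem_mul (FractionalIdeal.mem_coeIdeal_of_mem _ hm) ?_
      rw [FractionalIdeal.mem_inv_iff (FractionalIdeal.coeIdeal_ne_zero.2 hM0)]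
      intro y hy
      obtain ⟨z, hz, rfl⟩ := (FractionalIdeal.mem_coeIdeal A⁰).1 hy
      exact hx z hz
    · obtain ⟨t, ht, htN⟩ := SetLike.not_le_iff_exists.1
        (fun hle => hNM (hMmax.eq_of_le hN.ne_top hle).symm)
      exact ⟨t, htN, FractionalIdeal.coe_ideal_le_self_mul_inv _ _
        (FractionalIdeal.mem_coeIdeal_of_mem _ ht)⟩
  obtain ⟨p, q, hq, rfl⟩ := IsFractionRing.div_surjective (A := A) x
  have hq0 : q ≠ 0 := nonZeroDivisors.ne_zero hq
  have hq0' : algebraMap A (FractionRing A) q ≠ 0 := by simpa using hq0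
  have hmul : ∀ m ∈ M, ∃ r ∈ M, m * p = r * q := by
    intro m hm
    obtain ⟨r, hr, hrm⟩ := hxM m hm
    refine ⟨r, hr, IsFractionRing.injective A (FractionRing A) ?_⟩
    rw [map_mul, map_mul, hrm]
    field_simp
  have hpq : p ∈ Ideal.span {q} := by
    refine mem_of_forall_maximal fun N hN => ?_
    by_cases hNM : N = M
    · subst hNM
      obtain ⟨r, hr, hrp⟩ := hmul u huM
      have h := congrArg (ordAt hA N) hrp
      rw [ordAt_mul, ordAt_mul, hu, add_comm, add_comm (ordAt hA N r)] at h
      have hle : ordAt hA N q ≤ ordAt hA N p := by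
        refine (ENat.add_le_add_iff_right ENat.one_ne_top).1 ?_
        rw [h]
        gcongr
        exact (one_le_ordAt_iff hA).2 hr
      obtain ⟨s, hs, r, hr⟩ := exists_mul_eq_mul_of_ordAt_le hA hle
      exact ⟨s, hs, Ideal.mem_span_singleton'.2 ⟨r, hr.symm⟩⟩
    · obtain ⟨t, ht, htN⟩ := SetLike.not_le_iff_exists.1
        (fun hle => hNM (hMmax.eq_of_le hN.ne_top hle).symm)
      obtain ⟨r, -, hr⟩ := hmul t ht
      exact ⟨t, htN, Ideal.mem_span_singleton'.2 ⟨r, hr.symm⟩⟩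
  obtain ⟨r, rfl⟩ := Ideal.mem_span_singleton'.1 hpq
  refine (FractionalIdeal.mem_one_iff A⁰).2 ⟨r, ?_⟩
  rw [map_mul, mul_div_cancel_right₀ _ hq0']

theorem mem_divisorialClosure_of_forall_mul_mem (hA : IsAlmostDedekind A) {M I : Ideal A}
    (hM : M ∈ noninvertibleMax A) (hI : I ≠ ⊥) {b : A} (hb : ∀ m ∈ M, b * m ∈ I) :
    algebraMap A _ b ∈ divisorialClosure I := by
  have hI' : (I : FractionalIdeal A⁰ (FractionRing A)) ≠ 0 :=
    FractionalIdeal.coeIdeal_ne_zero.2 hI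
  have hinv : (I : FractionalIdeal A⁰ (FractionRing A))⁻¹ ≠ 0 := by
    intro h
    have : (1 : FractionRing A) ∈ (I : FractionalIdeal A⁰ (FractionRing A))⁻¹ :=
      (FractionalIdeal.mem_inv_iff hI').2 fun y hy => by
        rw [one_mul]; exact FractionalIdeal.coeIdeal_le_one hy
    rw [h, FractionalIdeal.mem_zero_iff] at this
    exact one_ne_zero this
  rw [divisorialClosure, FractionalIdeal.mem_inv_iff hinv]
  intro y hy
  rw [FractionalIdeal.mem_inv_iff hI'] at hy
  refine mem_one_of_forall_mul_mem_one hA hM fun m hm => ?_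
  rw [mul_comm _ y, mul_assoc, ← map_mul]
  exact hy _ (FractionalIdeal.mem_coeIdeal_of_mem _ (hb m hm))

/-- The maximal ideals containing a nonzero element `a` form a Hausdorff space, because `A / a` is
zero-dimensional; so infinitely many of them contain an infinite discrete set. -/
theorem exists_infinite_isolated (hA : IsAlmostDedekind A) {a : A} (ha : a ≠ 0) {S : Set (Ideal A)}
    (hS : S.Infinite) (hmax : ∀ M ∈ S, M.IsMaximal) (haS : ∀ M ∈ S, a ∈ M) :
    ∃ T ⊆ S, T.Infinite ∧ ∀ M ∈ T, ∃ b ∉ M, ∀ N ∈ T, N ≠ M → b ∈ N := by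
  let X := {p : PrimeSpectrum A // p.asIdeal ∈ S}
  have hinj : Function.Injective fun x : X => x.1.asIdeal :=
    fun x y h => Subtype.ext (PrimeSpectrum.ext h)
  have : T2Space X := by
    refine ⟨fun x y hxy => ?_⟩
    have hx := hmax _ x.2
    obtain ⟨c, hcx, hcy⟩ := SetLike.not_le_iff_exists.1
      (fun hle => hxy (hinj (hx.eq_of_le (hmax _ y.2).ne_top hle)))
    obtain ⟨e, he⟩ := ENat.ne_top_iff_exists.1 (ordAt_ne_top hA (M := x.1.asIdeal) ha)
    obtain ⟨s, hs, r, hr⟩ := exists_mul_eq_mul_of_ordAt_le hA (M := x.1.asIdeal) (a := a)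
      (x := c ^ e) (he ▸ (le_ordAt_iff hA).2 (Ideal.pow_mem_pow hcx e))
    refine ⟨Subtype.val ⁻¹' PrimeSpectrum.basicOpen s, Subtype.val ⁻¹' PrimeSpectrum.basicOpen c,
      (PrimeSpectrum.basicOpen s).isOpen.preimage continuous_subtype_val,
      (PrimeSpectrum.basicOpen c).isOpen.preimage continuous_subtype_val, hs, hcy, ?_⟩
    rw [Set.disjoint_left]
    intro z hzs hzc
    have hz : s * c ^ e ∈ z.1.asIdeal := hr ▸ z.1.asIdeal.mul_mem_left r (haS _ z.2)
    exact (z.1.isPrime.mem_or_mem hz).elim hzs fun h => hzc (z.1.isPrime.mem_of_pow_mem e h)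
  have : Infinite X := by
    have := hS.to_subtype
    exact Infinite.of_injective (fun M : S => (⟨⟨M.1, (hmax _ M.2).isPrime⟩, M.2⟩ : X))
      fun M N h => Subtype.ext (congrArg (fun x : X => x.1.asIdeal) h)
  obtain ⟨D, hD, hDd⟩ := exists_infinite_discreteTopology X
  refine ⟨(fun x : X => x.1.asIdeal) '' D, ?_, hD.image hinj.injOn, ?_⟩
  · rintro _ ⟨x, -, rfl⟩
    exact x.2
  · rintro _ ⟨x, hx, rfl⟩
    obtain ⟨U, hU, hUD⟩ := isOpen_induced_iff.1 (isOpen_discrete ({⟨x, hx⟩} : Set D))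
    obtain ⟨W, hW, rfl⟩ := isOpen_induced_iff.1 hU
    have hxW : x.1 ∈ W := by
      have : (⟨x, hx⟩ : D) ∈ ({⟨x, hx⟩} : Set D) := rfl
      rw [← hUD] at this
      exact this
    obtain ⟨_, ⟨b, rfl⟩, hbx, hbW⟩ :=
      PrimeSpectrum.isTopologicalBasis_basic_opens.exists_subset_of_mem_open hxW hW
    refine ⟨b, hbx, ?_⟩
    rintro _ ⟨y, hy, rfl⟩ hyx
    by_contra hby
    have hyD : (⟨y, hy⟩ : D) ∈ ({⟨x, hx⟩} : Set D) := by
      rw [← hUD]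
      exact hbW hby
    obtain rfl : y = x := congrArg Subtype.val hyD
    exact hyx rfl

/-- Under weak factorization a nonzero element lies in only finitely many noninvertible maximal
ideals. Otherwise some infinite set `T` of them is discrete; its intersection `I` lies in every
member of `T` while `divisorialClosure I` lies in none, so that all members of `T` have to occur in
the finite product relating the two. -/
theorem finite_noninvertibleMax (hA : IsAlmostDedekind A) (hW : HasWeakFactorization A) {a : A}
    (ha : a ≠ 0) : {M | M ∈ noninvertibleMax A ∧ a ∈ M}.Finite := by
  by_contra hinf
  obtain ⟨T, hTS, hT, hiso⟩ := exists_infinite_isolated hA ha hinf (fun M hM => hM.1.1)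
    fun M hM => hM.2
  have hI0 : sInf T ≠ ⊥ := fun h => ha (by
    have : a ∈ sInf T := Ideal.mem_sInf.2 fun {M} hM => (hTS hM).2
    rwa [h] at this)
  have hcl : ∀ M ∈ T, ∃ b ∉ M, algebraMap A _ b ∈ divisorialClosure (sInf T) := by
    intro M hM
    obtain ⟨b, hbM, hb⟩ := hiso M hM
    refine ⟨b, hbM, mem_divisorialClosure_of_forall_mul_mem hA (hTS hM).1 hI0 fun m hm =>
      Ideal.mem_sInf.2 fun {N} hN => ?_⟩
    by_cases hNM : N = M
    · exact hNM ▸ M.mul_mem_left b hm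
    · exact N.mul_mem_right m (hb N hN hNM)
  have hcoe : ∀ M ∈ T, ∀ x : A, algebraMap A (FractionRing A) x ∈
      ((sInf T : Ideal A) : FractionalIdeal A⁰ (FractionRing A)) → x ∈ M := by
    intro M hM x hx
    obtain ⟨y, hy, hyx⟩ := (FractionalIdeal.mem_coeIdeal A⁰).1 hx
    exact IsFractionRing.injective A (FractionRing A) hyx ▸ Ideal.mem_sInf.1 hy hM
  have hnd : ¬ IsDivisorial (sInf T) := by
    intro hd
    obtain ⟨M, hM⟩ := hT.nonempty
    obtain ⟨b, hbM, hb⟩ := hcl M hM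
    rw [hd] at hb
    exact hbM (hcoe M hM b hb)
  obtain ⟨s, hs, hprod⟩ := hW _ hI0 hnd
  refine hT ((Multiset.finite_toSet s).subset fun M hM => ?_)
  obtain ⟨b, hbM, hb⟩ := hcl M hM
  have hMp : M.IsPrime := (hTS hM).1.1.isPrime
  have hle : s.prod ≤ M := fun t ht => by
    refine (hMp.mem_or_mem (hcoe M hM (b * t) ?_)).resolve_left hbM
    rw [hprod, map_mul]
    exact FractionalIdeal.mul_mem_mul hb (FractionalIdeal.mem_coeIdeal_of_mem _ ht)
  obtain ⟨N, hN, hNM⟩ := (Ideal.IsPrime.multiset_prod_le hMp).1 hle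
  exact (hs N hN).eq_of_le hMp.ne_top hNM ▸ hN

/-! ### Clean ideals -/

/-- A finitely generated ideal inside `M` can be enlarged inside `M` so as to avoid finitely many
other maximal ideals. -/
theorem exists_fg_forall_not_le {A : Type*} [CommRing A] {M H₀ : Ideal A} [M.IsMaximal]
    (hH₀ : H₀.FG) (hle : H₀ ≤ M) {F : Set (Ideal A)} (hF : F.Finite) (hmax : ∀ N ∈ F, N.IsMaximal) :
    ∃ H : Ideal A, H.FG ∧ H₀ ≤ H ∧ H ≤ M ∧ ∀ N ∈ F, N ≠ M → ¬ H ≤ N := by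
  have hex : ∀ N, ∃ c ∈ M, N ∈ F → N ≠ M → c ∉ N := by
    intro N
    by_cases h : N ∈ F ∧ N ≠ M
    · obtain ⟨c, hc, hcN⟩ := SetLike.not_le_iff_exists.1
        (fun hle => h.2 (Ideal.IsMaximal.eq_of_le ‹_› (hmax N h.1).ne_top hle).symm)
      exact ⟨c, hc, fun _ _ => hcN⟩
    · exact ⟨0, M.zero_mem, fun h₁ h₂ => absurd ⟨h₁, h₂⟩ h⟩
  choose c hcM hcN using hex
  refine ⟨H₀ ⊔ Ideal.span (c '' F), Submodule.FG.sup hH₀ (Submodule.fg_span (hF.image c)),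
    le_sup_left, sup_le hle (Ideal.span_le.2 ?_), fun N hN hne hle => ?_⟩
  · rintro _ ⟨N, -, rfl⟩
    exact hcM N
  · exact hcN N hN hne (hle (Submodule.mem_sup_right (Ideal.subset_span ⟨N, hN, rfl⟩)))

theorem exists_isClean_le (hA : IsAlmostDedekind A) (hW : HasWeakFactorization A) {M : Ideal A}
    (hM : M ∈ noninvertibleMax A) : ∃ H ≤ M, IsClean H := by
  have := hM.1
  obtain ⟨u, hu⟩ := exists_ordAt_eq_one hA M
  have huM : u ∈ M := (one_le_ordAt_iff hA).1 hu.ge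
  have hu0 : u ≠ 0 := by
    rintro rfl
    exact absurd hu (by simp [ordAt])
  obtain ⟨H, hfg, huH, hHM, hH⟩ := exists_fg_forall_not_le (Submodule.fg_span_singleton u)
    ((Ideal.span_singleton_le_iff_mem M).2 huM) (finite_noninvertibleMax hA hW hu0)
    fun N hN => hN.1.1
  have huH : u ∈ H := huH (Ideal.mem_span_singleton_self u)
  refine ⟨H, hHM, isInvertible_of_fg hA (fun h => hu0 (by simpa [h] using huH)) hfg, M, ?_, ?_⟩
  · ext N
    constructor
    · rintro ⟨hN, hNZ⟩
      have hHN : H ≤ N := by simpa using hN.2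
      by_contra hne
      exact hH N ⟨hNZ, hHN huH⟩ hne hHN
    · rintro rfl
      exact ⟨⟨hM.1, by simpa using hHM⟩, hM⟩
  · intro hle
    have h := (le_ordAt_iff hA).2 (hle huH)
    rw [hu] at h
    norm_num at h

/-- If every noninvertible maximal ideal contains a clean ideal `H` with `V 2 H` finite, then `A`
has no critical maximal ideals: every maximal ideal contains a finitely generated ideal contained in
the square of no maximal ideal. -/
theorem exists_fg_forall_not_le_sq (hA : IsAlmostDedekind A)
    (hd : ∀ M ∈ noninvertibleMax A, ∃ H : Ideal A, H ≤ M ∧ IsClean H ∧ (V 2 H).Finite)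
    (M : Ideal A) [hM : M.IsMaximal] :
    ∃ H ≤ M, H.FG ∧ ∀ N : Ideal A, N.IsMaximal → ¬ H ≤ N ^ 2 := by
  by_cases hinv : IsInvertible M
  · refine ⟨M, le_rfl, hinv.fg, fun N hN hle => ?_⟩
    obtain rfl : M = N := hM.eq_of_le hN.ne_top (hle.trans (Ideal.pow_le_self two_ne_zero))
    exact not_le_sq_of_isRadical hA hM.isPrime.isRadical hinv.ne_bot M hle
  · obtain ⟨H₀, hH₀M, ⟨hH₀, M', hM', hsq⟩, hfin⟩ := hd M ⟨hM, hinv⟩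
    have hMM' : M ∈ ({M'} : Set (Ideal A)) := by
      rw [← hM']
      exact ⟨⟨hM, by simpa using hH₀M⟩, hM, hinv⟩
    obtain rfl : M = M' := hMM'
    obtain ⟨H, hfg, hH₀H, hHM, hH⟩ := exists_fg_forall_not_le hH₀.fg hH₀M hfin fun N hN => hN.1
    refine ⟨H, hHM, hfg, fun N hN hle => ?_⟩
    have hNM : N ≠ M := by
      rintro rfl
      exact hsq (hH₀H.trans hle)
    exact hH N ⟨hN, hH₀H.trans hle⟩ hNM (hle.trans (Ideal.pow_le_self two_ne_zero))

/-! ### Factorization into radical ideals -/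

/-- Let `H ⊆ M` be finitely generated and contained in the square of no maximal ideal. If `a` has
order `e` at `M`, then `s * H ^ e ⊆ a * A` for some `s ∉ M`, which bounds the order of `a` at the
maximal ideals `N` near `M` by `e`, and shows that `H ⊆ N` if moreover `a ∈ N`. -/
theorem exists_notMem_forall_ordAt_le (hA : IsAlmostDedekind A) {M H : Ideal A} [M.IsMaximal]
    (hHM : H ≤ M) (hfg : H.FG) (hH : ∀ N : Ideal A, N.IsMaximal → ¬ H ≤ N ^ 2) {a : A}
    (ha : a ≠ 0) :
    ∃ s ∉ M, ∀ (N : Ideal A) [N.IsMaximal], s ∉ N →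
      ordAt hA N a ≤ ordAt hA M a ∧ (a ∈ N → H ≤ N) := by
  obtain ⟨e, he⟩ := ENat.ne_top_iff_exists.1 (ordAt_ne_top hA (M := M) ha)
  obtain ⟨s, hs, hsH⟩ := exists_forall_mul_mem_of_fg (P := M) (J := Ideal.span {a})
    (Submodule.FG.pow hfg e) fun x hx => by
      obtain ⟨s, hs, r, hr⟩ := exists_mul_eq_mul_of_ordAt_le hA (M := M) (a := a) (x := x)
        (he ▸ (le_ordAt_iff hA).2 (Ideal.pow_right_mono hHM e hx))
      exact ⟨s, hs, Ideal.mem_span_singleton'.2 ⟨r, hr.symm⟩⟩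
  refine ⟨s, hs, fun N hN hsN => ⟨?_, fun haN h hh => ?_⟩⟩
  · obtain ⟨h, hhH, hhN⟩ := SetLike.not_le_iff_exists.1 (hH N hN)
    obtain ⟨r, hr⟩ := Ideal.mem_span_singleton'.1 (hsH _ (Ideal.pow_mem_pow hhH e))
    have hh1 : ordAt hA N h ≤ 1 := by
      rw [← le_ordAt_iff hA, not_le] at hhN
      exact Order.le_of_lt_add_one (by simpa [one_add_one_eq_two] using hhN)
    calc ordAt hA N a ≤ ordAt hA N (r * a) := by rw [ordAt_mul]; exact le_add_self
      _ = e * ordAt hA N h := by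
        rw [hr, ordAt_mul, ordAt_pow, (ordAt_eq_zero_iff hA).2 hsN, zero_add]
      _ ≤ e * 1 := by gcongr
      _ = ordAt hA M a := by rw [mul_one, he]
  · obtain ⟨r, hr⟩ := Ideal.mem_span_singleton'.1 (hsH _ (Ideal.pow_mem_pow hh e))
    have hmem : s * h ^ e ∈ N := hr ▸ N.mul_mem_left r haN
    exact hN.isPrime.mem_of_pow_mem e ((hN.isPrime.mem_or_mem hmem).resolve_left hsN)

theorem exists_forall_ordAt_le (hA : IsAlmostDedekind A)
    (hcrit : ∀ (M : Ideal A) [M.IsMaximal],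
      ∃ H ≤ M, H.FG ∧ ∀ N : Ideal A, N.IsMaximal → ¬ H ≤ N ^ 2) {a : A} (ha : a ≠ 0) :
    ∃ n : ℕ, ∀ (N : Ideal A) [N.IsMaximal], ordAt hA N a ≤ n := by
  -- The elements `s` such that the order of `a` is bounded where `s` does not vanish.
  let K : Ideal A :=
    { carrier := {s | ∃ n : ℕ, ∀ (N : Ideal A) [N.IsMaximal], s ∉ N → ordAt hA N a ≤ n}
      zero_mem' := ⟨0, fun N _ h => absurd N.zero_mem h⟩
      add_mem' := by
        rintro s t ⟨m, hm⟩ ⟨n, hn⟩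
        refine ⟨max m n, fun N _ h => ?_⟩
        by_cases hs : s ∈ N
        · exact (hn N fun ht => h (N.add_mem hs ht)).trans (by exact_mod_cast le_max_right m n)
        · exact (hm N hs).trans (by exact_mod_cast le_max_left m n)
      smul_mem' := by
        rintro r s ⟨n, hn⟩
        exact ⟨n, fun N _ h => hn N fun hs => h (N.mul_mem_left r hs)⟩ }
  have hK : K = ⊤ := by
    by_contra hne
    obtain ⟨M, hM, hKM⟩ := K.exists_le_maximal hne
    obtain ⟨H, hHM, hfg, hH⟩ := hcrit M
    obtain ⟨s, hs, hsN⟩ := exists_notMem_forall_ordAt_le hA hHM hfg hH ha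
    obtain ⟨e, he⟩ := ENat.ne_top_iff_exists.1 (ordAt_ne_top hA (M := M) ha)
    exact hs (hKM ⟨e, fun N _ h => he ▸ (hsN N h).1⟩)
  obtain ⟨n, hn⟩ := (Ideal.eq_top_iff_one K).1 hK
  exact ⟨n, fun N hN => hn N ((Ideal.ne_top_iff_one N).1 hN.ne_top)⟩

theorem isRadical_sInf_V {A : Type*} [CommRing A] (n : ℕ) (I : Ideal A) :
    (sInf (V n I)).IsRadical := by
  rintro x ⟨k, hk⟩
  exact Ideal.mem_sInf.2 fun {N} hN => hN.1.isPrime.mem_of_pow_mem k (Ideal.mem_sInf.1 hk hN)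

/-- The order of `⋂ V (k + 1) I` at a maximal ideal `M` is at most `1`, and it is `0` if `M` does
not belong to `V (k + 1) I`; here `e` is the order of `I` at `M`. -/
theorem exists_mem_sInf_V (hA : IsAlmostDedekind A)
    (hcrit : ∀ (M : Ideal A) [M.IsMaximal],
      ∃ H ≤ M, H.FG ∧ ∀ N : Ideal A, N.IsMaximal → ¬ H ≤ N ^ 2) {I : Ideal A} {c : A}
    (hcI : c ∈ I) (hc : c ≠ 0) (M : Ideal A) [M.IsMaximal] {e : ℕ} (he : ordAt hA M c = e)
    (k : ℕ) :
    ∃ q ∈ sInf (V (k + 1) I), ordAt hA M q ≤ if k < e then 1 else 0 := by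
  obtain ⟨H, hHM, hfg, hH⟩ := hcrit M
  obtain ⟨s, hs, hsN⟩ := exists_notMem_forall_ordAt_le hA hHM hfg hH hc
  have hs0 := (ordAt_eq_zero_iff hA).2 hs
  split_ifs with hk
  · obtain ⟨h, hhH, hhM⟩ := SetLike.not_le_iff_exists.1 (hH M ‹_›)
    refine ⟨s * h, Ideal.mem_sInf.2 fun {N} hN => ?_, ?_⟩
    · have := hN.1
      by_cases hsN' : s ∈ N
      · exact N.mul_mem_right h hsN'
      · exact N.mul_mem_left s ((hsN N hsN').2 (Ideal.pow_le_self k.succ_ne_zero (hN.2 hcI)) hhH)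
    · rw [← le_ordAt_iff hA, not_le] at hhM
      rw [ordAt_mul, hs0, zero_add]
      exact Order.le_of_lt_add_one (by simpa [one_add_one_eq_two] using hhM)
  · refine ⟨s, Ideal.mem_sInf.2 fun {N} hN => ?_, hs0.le⟩
    have := hN.1
    by_contra hsN'
    have h := ((le_ordAt_iff hA).2 (hN.2 hcI)).trans ((hsN N hsN').1.trans he.le)
    exact hk (by exact_mod_cast h)

/-- An almost Dedekind domain without critical maximal ideals is an SP-domain: the orders of a
nonzero ideal `I` are bounded by some `n`, and `I = ∏ k < n, ⋂ V (k + 1) I`. -/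
theorem isSPDomain_of_forall_exists_fg (hA : IsAlmostDedekind A)
    (hcrit : ∀ (M : Ideal A) [M.IsMaximal],
      ∃ H ≤ M, H.FG ∧ ∀ N : Ideal A, N.IsMaximal → ¬ H ≤ N ^ 2) : IsSPDomain A := by
  intro I
  by_cases hI : I = ⊥
  · exact ⟨{⊥}, by simpa using (Ideal.isPrime_bot (α := A)).isRadical, by simp [hI]⟩
  obtain ⟨a, haI, ha⟩ := Submodule.exists_mem_ne_zero_of_ne_bot hI
  obtain ⟨n, hn⟩ := exists_forall_ordAt_le hA hcrit ha
  refine ⟨(Multiset.range n).map fun k => sInf (V (k + 1) I), ?_, ?_⟩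
  · simp only [Multiset.mem_map]
    rintro _ ⟨k, -, rfl⟩
    exact isRadical_sInf_V _ _
  change I = ∏ k ∈ Finset.range n, sInf (V (k + 1) I)
  have hne : ∏ k ∈ Finset.range n, sInf (V (k + 1) I) ≠ ⊥ := by
    refine Finset.prod_ne_zero_iff.2 fun k _ h => hI (eq_bot_iff.2 ?_)
    rw [← Ideal.zero_eq_bot, ← h]
    exact le_sInf fun N hN => hN.2.trans (Ideal.pow_le_self k.succ_ne_zero)
  refine le_antisymm (le_of_forall_le_pow hA hne fun M hM j hle => ?_)
    (le_of_forall_le_pow hA hI fun M hM j hle => ?_)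
  · obtain ⟨c, hcI, hc0, hc⟩ := exists_ordAt_minimal hA M hI
    obtain ⟨e, he⟩ := ENat.ne_top_iff_exists.1 (ordAt_ne_top hA (M := M) hc0)
    choose q hq hqM using exists_mem_sInf_V hA hcrit hcI hc0 M he.symm
    have hsum : ordAt hA M (∏ k ∈ Finset.range n, q k) ≤ e := by
      have hprod : ∀ m : ℕ, ordAt hA M (∏ k ∈ Finset.range m, q k) ≤ min m e := by
        intro m
        induction m with
        | zero => simp [ordAt]
        | succ m ih =>
          rw [Finset.prod_range_succ, ordAt_mul]
          refine (add_le_add ih (hqM m)).trans ?_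
          norm_cast
          split_ifs <;> omega
      exact (hprod n).trans (by exact_mod_cast min_le_right n e)
    have hj := (le_ordAt_iff hA).2 (hle (Ideal.prod_mem_prod fun k _ => hq k))
    exact fun x hx => (le_ordAt_iff hA).1 ((hj.trans hsum).trans (he ▸ hc x hx))
  · have hjn : j ≤ n := by
      exact_mod_cast ((le_ordAt_iff hA).2 (hle haI)).trans (hn M)
    refine (Ideal.le_of_dvd (Finset.prod_dvd_prod_of_subset _ _ _
      (Finset.range_subset_range.2 hjn))).trans ?_
    calc ∏ k ∈ Finset.range j, sInf (V (k + 1) I) ≤ ∏ _k ∈ Finset.range j, M :=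
          Finset.prod_le_prod' fun k hk =>
            sInf_le ⟨hM, hle.trans (Ideal.pow_le_pow_right (Finset.mem_range.1 hk))⟩
      _ = M ^ j := by simp

/-! ### Clean ideals in ISP-domains -/

theorem finite_V_one_sup (hA : IsAlmostDedekind A) {H M K : Ideal A}
    (hH : IsInvertible H) (hM : V 1 H ∩ noninvertibleMax A = {M}) (hK : ¬ K ≤ M) :
    (V 1 (H ⊔ K)).Finite := by
  refine finite_V_one hA (ne_bot_of_le_ne_bot hH.ne_bot le_sup_left) fun N hN => ?_
  by_contra hinv
  have hle : H ⊔ K ≤ N := by simpa using hN.2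
  have hNM : N ∈ ({M} : Set (Ideal A)) :=
    hM ▸ ⟨⟨hN.1, by simpa using le_sup_left.trans hle⟩, hN.1, hinv⟩
  obtain rfl : N = M := hNM
  exact hK (le_sup_right.trans hle)

/-- Suppose that `V 2 H` is infinite and split it into infinite sets `S` and `T`. Let `M` be the
noninvertible maximal ideal above `H`. The ideal `I` of all elements of `M` that lie in `N ^ 2` for
all `N ∈ S` has order `1` at `M` and order `0` at all members of `T`. In a factorization
of `I` some factor is contained in `M`. If it is the invertible factor, then it is contained in
`H` near `M`, in particular at some member of `T`. If it is a radical factor, then the remaining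
factors are trivial near `M`, so `I` has order at most `1` at some member of `S`. Both are
impossible. -/
theorem IsClean.finite_V_two (hA : IsAlmostDedekind A) (hISP : IsISPDomain A) {H : Ideal A}
    (hclean : IsClean H) : (V 2 H).Finite := by
  obtain ⟨hH, M, hM, hHsq⟩ := hclean
  by_contra hinf
  have hMmem : M ∈ V 1 H ∩ noninvertibleMax A := hM ▸ rfl
  have hMmax : M.IsMaximal := hMmem.2.1
  have hHM : H ≤ M := by simpa using hMmem.1.2
  obtain ⟨S, T, hST, hdisj, hcard⟩ :=
    Set.Infinite.exists_union_disjoint_cardinal_eq_of_infinite hinf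
  have hfin : S.Finite ↔ T.Finite := by
    rw [← Cardinal.lt_aleph0_iff_set_finite, ← Cardinal.lt_aleph0_iff_set_finite, hcard]
  have hS : S.Infinite := fun h => hinf (hST ▸ h.union (hfin.1 h))
  have hT : T.Infinite := fun h => hinf (hST ▸ (hfin.2 h).union h)
  have hSV : ∀ N ∈ S, N ∈ V 2 H := fun N hN => hST ▸ Or.inl hN
  have hTV : ∀ N ∈ T, N ∈ V 2 H := fun N hN => hST ▸ Or.inr hN
  set I : Ideal A := M ⊓ ⨅ N ∈ S, N ^ 2 with hIdef
  have hmemI : ∀ x, x ∈ I ↔ x ∈ M ∧ ∀ N ∈ S, x ∈ N ^ 2 := fun x => by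
    simp [hIdef, Submodule.mem_iInf]
  have hHI : H ≤ I := fun x hx => (hmemI x).2 ⟨hHM hx, fun N hN => (hSV N hN).2 hx⟩
  have hIM : I ≤ M := inf_le_left
  have hIS : ∀ N ∈ S, I ≤ N ^ 2 := fun N hN x hx => ((hmemI x).1 hx).2 N hN
  have hIT : ∀ N ∈ T, ¬ I ≤ N := by
    intro N hN hle
    have hNmax := (hTV N hN).1
    have hNM : N ≠ M := by
      rintro rfl
      exact hHsq (hTV N hN).2
    have hinv : IsInvertible N := by
      by_contra hinv
      have : N ∈ ({M} : Set (Ideal A)) := hM ▸ ⟨⟨hNmax, by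
        simpa using (hTV N hN).2.trans (Ideal.pow_le_self two_ne_zero)⟩, hNmax, hinv⟩
      exact hNM this
    obtain ⟨h, hhH, hh0⟩ := Submodule.exists_mem_ne_zero_of_ne_bot hH.ne_bot
    obtain ⟨b, hbN, hb⟩ := exists_notMem_forall_mem_pow hA hinv hh0
    refine hbN (hle ((hmemI b).2 ⟨by simpa using hb M hMmax hNM.symm 1 (by simpa using hHM hhH),
      fun N' hN' => hb N' (hSV N' hN').1 ?_ 2 ((hSV N' hN').2 hhH)⟩))
    rintro rfl
    exact Set.disjoint_left.1 hdisj hN' hN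
  have hI0 : I ≠ ⊥ := ne_bot_of_le_ne_bot hH.ne_bot hHI
  obtain ⟨J, s, hJ, -, hs, hIJ⟩ := hISP I hI0 fun h => hMmax.ne_top (top_le_iff.1 (h ▸ hIM))
  have hIle : J * s.prod ≤ M := hIJ ▸ hIM
  rcases hMmax.isPrime.mul_le.1 hIle with hJM | hsM
  · obtain ⟨h, hhH, hhM⟩ := SetLike.not_le_iff_exists.1 hHsq
    have hh1 : ordAt hA M h ≤ 1 := by
      rw [← le_ordAt_iff hA, not_le] at hhM
      exact Order.le_of_lt_add_one (by simpa [one_add_one_eq_two] using hhM)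
    obtain ⟨t, ht, htJ⟩ := exists_forall_mul_mem_of_fg (P := M) (J := H) hJ.fg fun x hx => by
      obtain ⟨t, ht, r, hr⟩ := exists_mul_eq_mul_of_ordAt_le hA (M := M) (a := h) (x := x)
        (hh1.trans ((one_le_ordAt_iff hA).2 (hJM hx)))
      exact ⟨t, ht, hr ▸ H.mul_mem_left r hhH⟩
    refine hT ((finite_V_one_sup hA hH hM (K := Ideal.span {t}) ?_).subset fun N hN => ?_)
    · rwa [Ideal.span_singleton_le_iff_mem]
    · have hNmax := (hTV N hN).1
      have hHN : H ≤ N := (hTV N hN).2.trans (Ideal.pow_le_self two_ne_zero)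
      refine ⟨hNmax, ?_⟩
      rw [pow_one]
      refine sup_le hHN ((Ideal.span_singleton_le_iff_mem _).2 ?_)
      by_contra htN
      refine hIT N hN ?_
      rw [hIJ]
      exact Ideal.mul_le_left.trans fun x hx =>
        (hNmax.isPrime.mem_or_mem (hHN (htJ x hx))).resolve_left htN
  · obtain ⟨Q, hQs, hQM⟩ := (Ideal.IsPrime.multiset_prod_le hMmax.isPrime).1 hsM
    obtain ⟨s', rfl⟩ := Multiset.exists_cons_of_mem hQs
    have hIQ : I = Q * (J * s'.prod) := by
      rw [hIJ, Multiset.prod_cons]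
      ring
    set R := J * s'.prod with hR
    have hRM : ¬ R ≤ M := fun hRM => hHsq (hHI.trans (by
      rw [hIQ, pow_two]
      exact Ideal.mul_mono hQM hRM))
    have hQ0 : Q ≠ ⊥ := by
      rintro rfl
      exact hI0 (by rw [hIQ, Ideal.bot_mul])
    refine hS ((finite_V_one_sup hA hH hM hRM).subset fun N hN => ?_)
    have hNmax := (hSV N hN).1
    refine ⟨hNmax, ?_⟩
    rw [pow_one]
    refine sup_le ((hSV N hN).2.trans (Ideal.pow_le_self two_ne_zero)) ?_
    by_contra hRN
    obtain ⟨r, hrR, hrN⟩ := SetLike.not_le_iff_exists.1 hRN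
    refine not_le_sq_of_isRadical hA (hs Q hQs).2 hQ0 N fun x hx => ?_
    refine (Ideal.IsMaximal.mul_mem_pow N (a := r) (b := x) (hIS N hN ?_)).resolve_left hrN
    rw [hIQ, mul_comm r x]
    exact Ideal.mul_mem_mul hx hrR

theorem IsSPDomain.isISPDomain {A : Type*} [CommRing A] (h : IsSPDomain A) : IsISPDomain A := by
  classical
  intro I _ hI
  obtain ⟨s, hs, rfl⟩ := h I
  have hprod : s.prod = (s.filter (· ≠ ⊤)).prod := by
    rw [← Multiset.prod_filter_mul_prod_filter_not (p := (· ≠ ⊤)) (s := s)]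
    have : (s.filter fun Q => ¬ Q ≠ ⊤).prod = 1 :=
      Multiset.prod_eq_one fun Q hQ => by simpa using (Multiset.mem_filter.1 hQ).2
    rw [this, mul_one]
  refine ⟨1, s.filter (· ≠ ⊤), ?_, fun h0 => hI ?_, fun Q hQ => ?_, by rw [one_mul, ← hprod]⟩
  · rw [IsInvertible, Ideal.one_eq_top, FractionalIdeal.coeIdeal_top]
    exact isUnit_one
  · rw [hprod, h0, Multiset.prod_zero, Ideal.one_eq_top]
  · exact ⟨(Multiset.mem_filter.1 hQ).2, hs Q (Multiset.mem_filter.1 hQ).1⟩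

end SemiprimeFactorization

theorem theorem3p3 {A : Type*} [CommRing A] [IsDomain A]
    (hA : SemiprimeFactorization.IsAlmostDedekind A)
    (hW : SemiprimeFactorization.HasWeakFactorization A) :
    List.TFAE [
      SemiprimeFactorization.IsSPDomain A,
      SemiprimeFactorization.IsISPDomain A,
      ∀ H : Ideal A, SemiprimeFactorization.IsClean H →
        (SemiprimeFactorization.V 2 H).Finite,
      ∀ M ∈ SemiprimeFactorization.noninvertibleMax A,
        ∃ H : Ideal A, H ≤ M ∧ SemiprimeFactorization.IsClean H ∧
          (SemiprimeFactorization.V 2 H).Finite] := by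
  tfae_have 1 → 2 := fun h => h.isISPDomain
  tfae_have 2 → 3 := fun h H hH => hH.finite_V_two hA h
  tfae_have 3 → 4 := fun h M hM => by
    obtain ⟨H, hHM, hH⟩ := SemiprimeFactorization.exists_isClean_le hA hW hM
    exact ⟨H, hHM, hH, h H hH⟩
  tfae_have 4 → 1 := fun h => SemiprimeFactorization.isSPDomain_of_forall_exists_fg hA
    fun M _ => SemiprimeFactorization.exists_fg_forall_not_le_sq hA h M
  tfae_finish
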